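/- Let $L,M,N,r_{\Sigma}$ be integers with $L\ge 1$, $M,r_\Sigma\ge 0$ and $r_{\Sigma}<N$, and let $p_1,\dots,p_L\ge 0$ with $\sum_i p_i=1$. Let $\Sigma_1,\dots,\Sigma_L\in\mathbb{R}^{N\times N}$ be random symmetric positive semidefinite matrices whose images $\mathcal{R}_i=\mathrm{Im}(\Sigma_i)$ have dimension $r_{\Sigma}$ and are independent random points of the Grassmann manifold of $r_\Sigma$-dimensional subspaces of $\mathbb{R}^N$, each having a probability density with respect to the uniform (rotation-invariant) measure. Let $\Phi\in\mathbb{R}^{M\times N}$ be a random matrix, independent of $(\mathcal{R}_1,\dots,\mathcal{R}_L)$, with a left rotation-invariant distribution, that is, its entries have a joint pdf $f$ with respect to Lebesgue measure such that $f(\Theta A)=f(A)$ (for almost every $A$) for every orthogonal $\Theta\in\mathbb{R}^{M\times M}$. Given $\Phi$ and $(\Sigma_i)_i$, consider the measurement $y=\Phi x+n$, where the class $C\in\{1,\dots,L\}$ satisfies $\mathbb{P}[C=i]=p_i$, the signal $x$ given $C=i$ is distributed as $\mathcal{N}(0,\Sigma_i)$, and the noise $n\sim\mathcal{N}(0,\sigma^2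 I)$ is independent of $(C,x)$. Let $P_e=\mathbb{P}[\hat C(y)\neq C]=\sum_i p_i\,\mathbb{P}[\hat C(y)\ne i\mid C=i]$ be the misclassification probability, for these $\Phi$ and $(\Sigma_i)_i$, of a maximum a posteriori classifier $\hat C(y)\in\arg\max_i p(y\mid C=i)\,p_i$ (ties broken in any measurable way), where $p(y\mid C=i)$ is the conditional pdf of $y$. Then: 1. almost surely, $\mathrm{rank}(\Phi\Sigma_i\Phi^T)=\min\{M,r_\Sigma\}$ for all $i$, and $\mathrm{rank}(\Phi(\Sigma_i+\Sigma_j)\Phi^T)=\min\{M,N,2r_\Sigma\}$ for all $i\ne j$; 2. if $r_\Sigma\ge 1$ and $M\ge r_\Sigma+1$, then almost surely $\lim_{\sigma^2\to 0}P_e=0$. In particular, $M=r_\Sigma+1$ measurements suffice, so that $r_\Sigma+1$ is an upper bound on the minimum number of measurements for which $\lim_{\sigma^2\to0}P_e=0$. -/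

import Mathlib

open MeasureTheory ProbabilityTheory Filter Topology
open scoped ENNReal

noncomputable section

namespace LowNoise

/-- Linearly independent `r`-tuples of vectors (`r`-frames) in `ℝ^N`. -/
abbrev Frame (N r : ℕ) : Type :=
  {v : Fin r → EuclideanSpace ℝ (Fin N) // LinearIndependent ℝ v}

/-- The Grassmann manifold of `r`-dimensional linear subspaces of `ℝ^N`. -/
def Grassmann (N r : ℕ) : Type :=
  {V : Submodule ℝ (EuclideanSpace ℝ (Fin N)) // Module.finrank ℝ V = r}

/-- The underlying linear subspace of a point of the Grassmann manifold. -/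
def Grassmann.toSubmodule {N r : ℕ} (V : Grassmann N r) :
    Submodule ℝ (EuclideanSpace ℝ (Fin N)) := V.1

/-- The subspace spanned by a frame. -/
def Frame.span {N r : ℕ} (v : Frame N r) : Grassmann N r :=
  ⟨Submodule.span ℝ (Set.range v.1), by
    simpa using finrank_span_eq_card v.2⟩

/-- The topology of the Grassmann manifold: the quotient topology of the space of frames. -/
instance (N r : ℕ) : TopologicalSpace (Grassmann N r) :=
  TopologicalSpace.coinduced Frame.span inferInstance

/-- The Borel σ-algebra of the Grassmann manifold. -/
instance (N r : ℕ) : MeasurableSpace (Grassmann N r) := borel _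

instance (N r : ℕ) : BorelSpace (Grassmann N r) := ⟨rfl⟩

/-- The uniform (rotation-invariant) probability measure on the Grassmann manifold (`r ≤ N`):
the law of the span of `r` independent standard Gaussian vectors of `ℝ^N`. Such vectors are almost
surely linearly independent, so restricting to frames loses no mass. -/
def Grassmann.uniform (N r : ℕ) : Measure (Grassmann N r) :=
  ((Measure.pi fun _ : Fin r => stdGaussian (EuclideanSpace ℝ (Fin N))).comap
    (Subtype.val : Frame N r → Fin r → EuclideanSpace ℝ (Fin N))).map Frame.span

/-- A distribution on the Grassmann manifold is continuous if it has a probability density function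
with respect to the uniform measure. -/
def Grassmann.HasDensity {N r : ℕ} (μ : Measure (Grassmann N r)) : Prop :=
  ∃ f : Grassmann N r → ℝ≥0∞, Measurable f ∧ μ = (Grassmann.uniform N r).withDensity f

/-- The distribution `μ` of (the entries of) a random `M × N` matrix is left rotation-invariant:
the entries have a joint pdf `p` with respect to Lebesgue measure, and `p (Θ A) = p A` for every
orthogonal `Θ`. (A pdf being determined almost everywhere only, the identity is required for almost
every `A`.) -/
def IsLeftRotationInvariant {M N : ℕ} (μ : Measure (Fin M → Fin N → ℝ)) : Prop :=
  ∃ p : (Fin M → Fin N → ℝ) → ℝ≥0∞, Measurable p ∧ μ = volume.withDensity p ∧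
    ∀ Θ ∈ Matrix.orthogonalGroup (Fin M) ℝ, ∀ᵐ A : Fin M → Fin N → ℝ,
      p (Θ * Matrix.of A : Matrix (Fin M) (Fin N) ℝ) = p A

/-- The conditional law of the measurement `y = Φ x + n` given the class, where
`x ∼ 𝒩(0, S)` and `n ∼ 𝒩(0, s I)` are independent; `s` is the noise variance `σ²`. -/
def measurementLaw {M N : ℕ} (Φ : Matrix (Fin M) (Fin N) ℝ) (S : Matrix (Fin N) (Fin N) ℝ)
    (s : ℝ) : Measure (EuclideanSpace ℝ (Fin M)) :=
  ((multivariateGaussian 0 S).prod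
      (multivariateGaussian 0 (s • (1 : Matrix (Fin M) (Fin M) ℝ)))).map
    fun q => Φ.toEuclideanLin q.1 + q.2

/-- The conditional pdf `p(y | C = i)` of the measurement. -/
def measurementPDF {M N : ℕ} (Φ : Matrix (Fin M) (Fin N) ℝ) (S : Matrix (Fin N) (Fin N) ℝ)
    (s : ℝ) : EuclideanSpace ℝ (Fin M) → ℝ≥0∞ :=
  (measurementLaw Φ S s).rnDeriv volume

/-- `c` is a maximum a posteriori classifier: a measurable map with
`c y ∈ argmax_i p(y | C = i) p_i` for (almost) every `y`, ties being broken arbitrarily. -/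
structure IsMAPClassifier {M N L : ℕ} (p : Fin L → ℝ) (Φ : Matrix (Fin M) (Fin N) ℝ)
    (S : Fin L → Matrix (Fin N) (Fin N) ℝ) (s : ℝ) (c : EuclideanSpace ℝ (Fin M) → Fin L) :
    Prop where
  measurable : Measurable c
  isArgmax : ∀ᵐ y, ∀ j, measurementPDF Φ (S j) s y * ENNReal.ofReal (p j) ≤
    measurementPDF Φ (S (c y)) s y * ENNReal.ofReal (p (c y))

/-- The misclassification probability `P[c(y) ≠ C] = ∑_i p_i P[c(y) ≠ i | C = i]`
of a classifier `c`. -/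
def errorProb {M N L : ℕ} (p : Fin L → ℝ) (Φ : Matrix (Fin M) (Fin N) ℝ)
    (S : Fin L → Matrix (Fin N) (Fin N) ℝ) (s : ℝ) (c : EuclideanSpace ℝ (Fin M) → Fin L) : ℝ :=
  ∑ i, p i * (measurementLaw Φ (S i) s).real {y | c y ≠ i}

end LowNoise

end

namespace LowNoise

/-! Ranks: `Φ S Φᵀ` with `S` positive semidefinite has the rank of `Φ` restricted to `Im S`, and `Im
(S + T) = Im S ⊔ Im T`. So only the random subspaces matter, and they may be represented by their
projection matrices. Two independent subspaces with densities are in general position because a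
fresh Gaussian vector avoids any fixed proper subspace (`Grassmann.ae_finrank_sup`). In the same way
the rows of `Φ`, having a joint density, lose no more rank than their number forces
(`ae_rank_mul_of_indepFun`).

Error: put `U_i = Φ (Im S_i)`. As the noise vanishes, class `i` puts its mass near `U_i`, while
class `j` puts none there if `U_j ⊄ U_i`, since a Gaussian does not charge subspaces missing part of
its covariance image. A MAP rule confuses `i` with `j` no more than the test "close to `U_i`" does
(`IsMAPClassifier.mul_measurementLaw_le`), so the error tends to 0 (`tendsto_errorProb`). For `0 < r
< min M N` the rank formulas exclude `U_j ≤ U_i`: it would give `U_i ⊔ U_j` dimension `r`, not `min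
M (min N (2 * r)) > r`. -/

theorem pi_absolutelyContinuous_pi : ∀ {n : ℕ} {α : Type*} [MeasurableSpace α]
    (μ ν : Fin n → Measure α) [∀ i, SigmaFinite (μ i)] [∀ i, SigmaFinite (ν i)],
    (∀ i, μ i ≪ ν i) → Measure.pi μ ≪ Measure.pi ν
  | 0, α, _, μ, ν, _, _, _ => by
    rw [Measure.pi_of_empty μ, Measure.pi_of_empty ν]
  | n + 1, α, _, μ, ν, _, _, h => by
    have hμ := (measurePreserving_piFinSuccAbove μ 0).symm
    have hν := (measurePreserving_piFinSuccAbove ν 0).symm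
    rw [← hμ.map_eq, ← hν.map_eq]
    exact ((h 0).prod (pi_absolutelyContinuous_pi _ _ fun i => h _)).map
      (MeasurableEquiv.measurable _)

/-! ### Densities of the Gaussian laws and vanishing noise -/

theorem stdGaussian_absolutelyContinuous (n : ℕ) :
    stdGaussian (EuclideanSpace ℝ (Fin n)) ≪ volume := by
  rw [← map_pi_eq_stdGaussian, ← (PiLp.volume_preserving_toLp (Fin n)).map_eq]
  exact (pi_absolutelyContinuous_pi _ _ fun _ =>
    gaussianReal_absolutelyContinuous 0 one_ne_zero).map (by fun_prop)

open scoped MatrixOrder in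
theorem multivariateGaussian_smul_one {n : ℕ} {s : ℝ} (hs : 0 < s) :
    multivariateGaussian (0 : EuclideanSpace ℝ (Fin n)) (s • (1 : Matrix (Fin n) (Fin n) ℝ)) =
      (stdGaussian (EuclideanSpace ℝ (Fin n))).map (fun x => √s • x) := by
  have h : CFC.sqrt (s • (1 : Matrix (Fin n) (Fin n) ℝ)) = √s • 1 := by
    refine CFC.sqrt_unique ?_ ?_
    · rw [smul_mul_smul_comm, Real.mul_self_sqrt hs.le, one_mul]
    · exact (Matrix.PosSemidef.one.smul (Real.sqrt_nonneg s)).nonneg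
  rw [multivariateGaussian, h]
  simp

theorem multivariateGaussian_smul_one_absolutelyContinuous {n : ℕ} {s : ℝ} (hs : 0 < s) :
    multivariateGaussian (0 : EuclideanSpace ℝ (Fin n)) (s • (1 : Matrix (Fin n) (Fin n) ℝ)) ≪
      volume := by
  rw [multivariateGaussian_smul_one hs]
  refine ((stdGaussian_absolutelyContinuous n).map (by fun_prop)).trans ?_
  rw [Measure.map_addHaar_smul _ (Real.sqrt_pos.2 hs).ne']
  exact Measure.smul_absolutelyContinuous

theorem measurable_measurement {M N : ℕ} (Φ : Matrix (Fin M) (Fin N) ℝ) :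
    Measurable fun q : EuclideanSpace ℝ (Fin N) × EuclideanSpace ℝ (Fin M) =>
      Φ.toEuclideanLin q.1 + q.2 :=
  ((LinearMap.continuous_of_finiteDimensional _).measurable.comp measurable_fst).add
    measurable_snd

/-- For each fixed signal the noise must fall in a translate of the null set, which is null. This
makes `measurementPDF` a genuine density of the law. -/
theorem measurementLaw_absolutelyContinuous {M N : ℕ} (Φ : Matrix (Fin M) (Fin N) ℝ)
    (S : Matrix (Fin N) (Fin N) ℝ) {s : ℝ} (hs : 0 < s) : measurementLaw Φ S s ≪ volume := by
  have hm := measurable_measurement Φ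
  refine Measure.AbsolutelyContinuous.mk fun A hA hA0 => ?_
  rw [measurementLaw, Measure.map_apply hm hA, Measure.measure_prod_null (hm hA)]
  refine Eventually.of_forall fun x => ?_
  refine multivariateGaussian_smul_one_absolutelyContinuous hs ?_
  have := measure_preimage_add (volume : Measure (EuclideanSpace ℝ (Fin M)))
    (Φ.toEuclideanLin x) A
  rw [hA0] at this
  exact this

theorem tendsto_noise_norm {n : ℕ} {ε : ℝ} (hε : 0 < ε) :
    Tendsto (fun s : ℝ => multivariateGaussian (0 : EuclideanSpace ℝ (Fin n))
      (s • (1 : Matrix (Fin n) (Fin n) ℝ)) {x | ε ≤ ‖x‖}) (𝓝[>] 0) (𝓝 0) := by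
  set γ := stdGaussian (EuclideanSpace ℝ (Fin n))
  have h1 : Tendsto (fun t : ℝ => γ {x | t < ‖x‖}) atTop (𝓝 0) := by
    simpa using tendsto_measure_norm_gt_of_isTightMeasureSet
      (isTightMeasureSet_singleton (μ := γ))
  -- The noise is `√s` times a standard vector, so the event is a tail at radius `ε / √s`. Halving
  -- `ε` makes the inequality strict.
  have h2 : Tendsto (fun s : ℝ => (√s)⁻¹ * (ε / 2)) (𝓝[>] 0) atTop := by
    refine Tendsto.atTop_mul_const (half_pos hε) (tendsto_inv_nhdsGT_zero.comp ?_)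
    refine tendsto_nhdsWithin_iff.2 ⟨?_, ?_⟩
    · simpa using (Real.continuous_sqrt.tendsto 0).mono_left nhdsWithin_le_nhds
    · filter_upwards [self_mem_nhdsWithin] with s hs using Real.sqrt_pos.2 hs
  refine tendsto_of_tendsto_of_tendsto_of_le_of_le' tendsto_const_nhds (h1.comp h2)
    (Eventually.of_forall fun _ => zero_le) ?_
  filter_upwards [self_mem_nhdsWithin] with s hs
  have hs' : 0 < √s := Real.sqrt_pos.2 hs
  rw [multivariateGaussian_smul_one hs, Measure.map_apply (by fun_prop)
    (measurableSet_le measurable_const measurable_norm)]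
  refine measure_mono fun x hx => ?_
  simp only [Set.mem_preimage, Set.mem_ofPred_eq, norm_smul, Real.norm_eq_abs,
    abs_of_pos hs'] at hx ⊢
  rw [inv_mul_lt_iff₀ hs']
  linarith

instance {M N : ℕ} (Φ : Matrix (Fin M) (Fin N) ℝ) (S : Matrix (Fin N) (Fin N) ℝ) (s : ℝ) :
    IsProbabilityMeasure (measurementLaw Φ S s) :=
  Measure.isProbabilityMeasure_map (measurable_measurement Φ).aemeasurable

/-! ### Gaussian mass near subspaces -/

open scoped MatrixOrder in
/-- A centered Gaussian vector avoids every subspace not containing the image of its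
covariance. -/
theorem multivariateGaussian_submodule_eq_zero {N : ℕ} {S : Matrix (Fin N) (Fin N) ℝ}
    (hS : S.PosSemidef) (K : Submodule ℝ (EuclideanSpace ℝ (Fin N)))
    (hK : ¬ LinearMap.range S.toEuclideanLin ≤ K) :
    multivariateGaussian 0 S (K : Set (EuclideanSpace ℝ (Fin N))) = 0 := by
  have hsq : CFC.sqrt S * CFC.sqrt S = S := CFC.sqrt_mul_sqrt_self _ hS.nonneg
  rw [multivariateGaussian, Measure.map_apply (by fun_prop)
    K.closed_of_finiteDimensional.measurableSet]
  refine stdGaussian_absolutelyContinuous N ?_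
  have : (fun x => 0 + (Matrix.toEuclideanCLM (𝕜 := ℝ) (CFC.sqrt S)) x) ⁻¹'
      (K : Set (EuclideanSpace ℝ (Fin N))) =
      (K.comap (CFC.sqrt S).toEuclideanLin : Set (EuclideanSpace ℝ (Fin N))) := by
    ext x
    simp
    rfl
  rw [this]
  refine Measure.addHaar_submodule _ _ fun htop => hK ?_
  rintro _ ⟨x, rfl⟩
  have hx : (CFC.sqrt S).toEuclideanLin x ∈ K.comap (CFC.sqrt S).toEuclideanLin := by
    rw [htop]; trivial
  rw [← hsq]
  simpa [Matrix.toLpLin_apply] using hx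

/-- The probability that the noiseless measurement is close to a subspace not containing the image
of the covariance is small. -/
theorem eventually_multivariateGaussian_infDist_lt {M N : ℕ} (Φ : Matrix (Fin M) (Fin N) ℝ)
    {S : Matrix (Fin N) (Fin N) ℝ} (hS : S.PosSemidef)
    (U : Submodule ℝ (EuclideanSpace ℝ (Fin M)))
    (hU : ¬ (LinearMap.range S.toEuclideanLin).map Φ.toEuclideanLin ≤ U) {η : ℝ≥0∞} (hη : 0 < η) :
    ∀ᶠ ε in 𝓝[>] (0 : ℝ),
      multivariateGaussian 0 S {x | Metric.infDist (Φ.toEuclideanLin x) U < ε} < η := by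
  have hc : Continuous Φ.toEuclideanLin := LinearMap.continuous_of_finiteDimensional _
  have hd : Continuous fun x => Metric.infDist (Φ.toEuclideanLin x) U :=
    (Metric.continuous_infDist_pt _).comp hc
  have h := tendsto_measure_biInter_gt (μ := multivariateGaussian 0 S) (a := (0 : ℝ))
    (s := fun ε => {x | Metric.infDist (Φ.toEuclideanLin x) U < ε})
    (fun ε _ => (measurableSet_lt hd.measurable measurable_const).nullMeasurableSet)
    (fun i j _ hij x hx => lt_of_lt_of_le hx hij)
    ⟨1, one_pos, measure_ne_top _ _⟩
  -- A subspace is closed, so being at distance below every `ε > 0` means lying in `U`. Continuity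
  -- from above then gives the limit.
  have h0 : multivariateGaussian 0 S
      (⋂ ε > (0 : ℝ), {x | Metric.infDist (Φ.toEuclideanLin x) U < ε}) = 0 := by
    refine measure_mono_null (fun x hx => ?_) (multivariateGaussian_submodule_eq_zero hS
      (U.comap Φ.toEuclideanLin) (by rwa [← Submodule.map_le_iff_le_comap]))
    have hx0 : Metric.infDist (Φ.toEuclideanLin x) U ≤ 0 :=
      le_of_forall_gt fun ε hε => (Set.mem_iInter₂.1 hx ε hε : _)
    have : Φ.toEuclideanLin x ∈ closure (U : Set (EuclideanSpace ℝ (Fin M))) :=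
      (Metric.mem_closure_iff_infDist_zero U.nonempty).2 (le_antisymm hx0 Metric.infDist_nonneg)
    rwa [U.closed_of_finiteDimensional.closure_eq] at this
  rw [h0] at h
  exact h.eventually_lt_const hη

theorem measurementLaw_apply_le {M N : ℕ} (Φ : Matrix (Fin M) (Fin N) ℝ)
    (S : Matrix (Fin N) (Fin N) ℝ) (s : ℝ) {A : Set (EuclideanSpace ℝ (Fin M))}
    (hA : MeasurableSet A) (B : Set (EuclideanSpace ℝ (Fin N))) (C : Set (EuclideanSpace ℝ (Fin M)))
    (h : ∀ x n, Φ.toEuclideanLin x + n ∈ A → x ∈ B ∨ n ∈ C) :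
    measurementLaw Φ S s A ≤ multivariateGaussian 0 S B +
      multivariateGaussian 0 (s • (1 : Matrix (Fin M) (Fin M) ℝ)) C := by
  rw [measurementLaw, Measure.map_apply (measurable_measurement Φ) hA]
  set μ := multivariateGaussian 0 S
  set ν := multivariateGaussian 0 (s • (1 : Matrix (Fin M) (Fin M) ℝ))
  calc _ ≤ μ.prod ν (B ×ˢ Set.univ ∪ Set.univ ×ˢ C) := by
        refine measure_mono fun q hq => ?_
        simpa using h q.1 q.2 hq
    _ ≤ _ := measure_union_le _ _
    _ = _ := by simp [Measure.prod_prod]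

theorem finrank_range_toEuclideanLin {m n : ℕ} (A : Matrix (Fin m) (Fin n) ℝ) :
    Module.finrank ℝ (LinearMap.range A.toEuclideanLin) = A.rank := by
  rw [Matrix.toEuclideanLin, Matrix.toLpLin_eq_toLin]
  exact (Matrix.rank_eq_finrank_range_toLin A _ _).symm

open scoped MatrixOrder in
theorem range_toEuclideanLin_sqrt {N : ℕ} {S : Matrix (Fin N) (Fin N) ℝ} (hS : S.PosSemidef) :
    LinearMap.range (CFC.sqrt S).toEuclideanLin = LinearMap.range S.toEuclideanLin := by
  have hsq : CFC.sqrt S * CFC.sqrt S = S := CFC.sqrt_mul_sqrt_self _ hS.nonneg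
  have hsym : (CFC.sqrt S).conjTranspose = CFC.sqrt S :=
    (Matrix.nonneg_iff_posSemidef.1 (CFC.sqrt_nonneg S)).isHermitian
  symm
  refine Submodule.eq_of_le_of_finrank_eq ?_ ?_
  · rintro _ ⟨x, rfl⟩
    refine ⟨(CFC.sqrt S).toEuclideanLin x, ?_⟩
    conv_rhs => rw [← hsq]
    simp [Matrix.toLpLin_apply]
  · have h := Matrix.rank_conjTranspose_mul_self (CFC.sqrt S)
    rw [hsym, hsq] at h
    rw [finrank_range_toEuclideanLin, finrank_range_toEuclideanLin, h]

open scoped MatrixOrder in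
theorem multivariateGaussian_range_compl {N : ℕ} {S : Matrix (Fin N) (Fin N) ℝ}
    (hS : S.PosSemidef) :
    multivariateGaussian 0 S
      (LinearMap.range S.toEuclideanLin : Set (EuclideanSpace ℝ (Fin N)))ᶜ = 0 := by
  rw [multivariateGaussian, Measure.map_apply (by fun_prop)
    (Submodule.closed_of_finiteDimensional _).measurableSet.compl]
  convert measure_empty (μ := stdGaussian (EuclideanSpace ℝ (Fin N)))
  refine Set.eq_empty_of_forall_notMem fun x hx => hx ?_
  rw [← range_toEuclideanLin_sqrt hS]
  exact ⟨x, by simp; rfl⟩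

theorem measurableSet_infDist_lt {M : ℕ} (U : Submodule ℝ (EuclideanSpace ℝ (Fin M))) (ε : ℝ) :
    MeasurableSet {y : EuclideanSpace ℝ (Fin M) | Metric.infDist y U < ε} :=
  measurableSet_lt measurable_infDist measurable_const

/-- Almost surely the signal lies in the image of `S`, so the distance from the measurement to the
measured image is at most the noise norm. -/
theorem measurementLaw_compl_infDist_lt_le {M N : ℕ} (Φ : Matrix (Fin M) (Fin N) ℝ)
    {S : Matrix (Fin N) (Fin N) ℝ} (hS : S.PosSemidef) (s ε : ℝ) :
    measurementLaw Φ S s {y | Metric.infDist y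
        ((LinearMap.range S.toEuclideanLin).map Φ.toEuclideanLin) < ε}ᶜ ≤
      multivariateGaussian 0 (s • (1 : Matrix (Fin M) (Fin M) ℝ)) {n | ε ≤ ‖n‖} := by
  refine (measurementLaw_apply_le Φ S s (measurableSet_infDist_lt _ ε).compl
    (LinearMap.range S.toEuclideanLin : Set (EuclideanSpace ℝ (Fin N)))ᶜ {n | ε ≤ ‖n‖} ?_).trans ?_
  · intro x n hy
    by_contra! hcon
    obtain ⟨hx, hn⟩ := hcon
    refine hy (show Metric.infDist _ _ < ε from lt_of_le_of_lt ?_ (not_le.1 hn))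
    have := Metric.infDist_le_dist_of_mem (x := Φ.toEuclideanLin x + n)
      (Submodule.mem_map_of_mem (f := Φ.toEuclideanLin) (not_not.1 hx))
    simpa [dist_eq_norm] using this
  · rw [multivariateGaussian_range_compl hS, zero_add]

theorem measurementLaw_infDist_lt_le {M N : ℕ} (Φ : Matrix (Fin M) (Fin N) ℝ)
    (S : Matrix (Fin N) (Fin N) ℝ) (U : Submodule ℝ (EuclideanSpace ℝ (Fin M))) (s ε : ℝ) :
    measurementLaw Φ S s {y | Metric.infDist y U < ε} ≤
      multivariateGaussian 0 S {x | Metric.infDist (Φ.toEuclideanLin x) U < 2 * ε} +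
      multivariateGaussian 0 (s • (1 : Matrix (Fin M) (Fin M) ℝ)) {n | ε ≤ ‖n‖} := by
  refine measurementLaw_apply_le Φ S s (measurableSet_infDist_lt U ε) _ _ fun x n hy => ?_
  by_contra! hcon
  obtain ⟨hx, hn⟩ := hcon
  refine hx ?_
  have h1 : Metric.infDist (Φ.toEuclideanLin x) U ≤ Metric.infDist (Φ.toEuclideanLin x + n) U +
      dist (Φ.toEuclideanLin x) (Φ.toEuclideanLin x + n) := Metric.infDist_le_infDist_add_dist
  have h2 : dist (Φ.toEuclideanLin x) (Φ.toEuclideanLin x + n) = ‖n‖ := by simp [dist_eq_norm]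
  have h3 : Metric.infDist (Φ.toEuclideanLin x + n) U < ε := hy
  have h4 : ‖n‖ < ε := not_le.1 hn
  change _ < 2 * ε
  linarith

/-! ### Error of maximum a posteriori classifiers -/

/-- A maximum a posteriori classifier confuses two classes no more than any test region does. -/
theorem IsMAPClassifier.mul_measurementLaw_le {M N L : ℕ} {p : Fin L → ℝ}
    {Φ : Matrix (Fin M) (Fin N) ℝ} {S : Fin L → Matrix (Fin N) (Fin N) ℝ} {s : ℝ} (hs : 0 < s)
    {c : EuclideanSpace ℝ (Fin M) → Fin L} (hc : IsMAPClassifier p Φ S s c) (i j : Fin L)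
    {A : Set (EuclideanSpace ℝ (Fin M))} (hA : MeasurableSet A) :
    ENNReal.ofReal (p i) * measurementLaw Φ (S i) s {y | c y = j} ≤
      ENNReal.ofReal (p i) * measurementLaw Φ (S i) s Aᶜ +
        ENNReal.ofReal (p j) * measurementLaw Φ (S j) s A := by
  have hlaw : ∀ k, ∀ E, MeasurableSet E → ENNReal.ofReal (p k) * measurementLaw Φ (S k) s E =
      ∫⁻ y in E, measurementPDF Φ (S k) s y * ENNReal.ofReal (p k) := by
    intro k E hE
    have hm : Measurable (measurementPDF Φ (S k) s) := Measure.measurable_rnDeriv _ _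
    rw [lintegral_mul_const _ hm, mul_comm]
    congr 1
    conv_lhs => rw [← Measure.withDensity_rnDeriv_eq _ _
      (measurementLaw_absolutelyContinuous Φ (S k) hs)]
    rw [withDensity_apply _ hE]
    rfl
  have hcj : MeasurableSet {y | c y = j} := hc.measurable (measurableSet_singleton j)
  -- Where the rule answers `j`, the weighted density of class `j` dominates that of class `i`;
  -- integrate over the part inside `A`.
  have key : ENNReal.ofReal (p i) * measurementLaw Φ (S i) s ({y | c y = j} ∩ A) ≤
      ENNReal.ofReal (p j) * measurementLaw Φ (S j) s ({y | c y = j} ∩ A) := by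
    rw [hlaw i _ (hcj.inter hA), hlaw j _ (hcj.inter hA)]
    refine lintegral_mono_ae ?_
    filter_upwards [ae_restrict_mem (hcj.inter hA), ae_restrict_of_ae hc.isArgmax] with y hy hmax
    have := hmax i
    rwa [show c y = j from hy.1] at this
  calc _ ≤ ENNReal.ofReal (p i) * (measurementLaw Φ (S i) s Aᶜ +
        measurementLaw Φ (S i) s ({y | c y = j} ∩ A)) := by
        gcongr
        refine (measure_mono fun y hy => ?_).trans (measure_union_le _ _)
        by_cases hyA : y ∈ A
        · exact Or.inr ⟨hy, hyA⟩
        · exact Or.inl hyA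
    _ ≤ _ := by
        rw [mul_add]
        refine add_le_add le_rfl (key.trans ?_)
        gcongr
        exact Set.inter_subset_right

/-- The misclassification probability of maximum a posteriori classifiers vanishes in the low noise
limit as soon as no image of a class covariance, once measured, contains another one. -/
theorem tendsto_errorProb {M N L : ℕ} (p : Fin L → ℝ) (hp0 : ∀ i, 0 ≤ p i) (hp1 : ∑ i, p i = 1)
    (Φ : Matrix (Fin M) (Fin N) ℝ) (S : Fin L → Matrix (Fin N) (Fin N) ℝ)
    (hS : ∀ i, (S i).PosSemidef)
    (hU : ∀ i j, i ≠ j → ¬ (LinearMap.range (S j).toEuclideanLin).map Φ.toEuclideanLin ≤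
      (LinearMap.range (S i).toEuclideanLin).map Φ.toEuclideanLin)
    (c : ℝ → EuclideanSpace ℝ (Fin M) → Fin L)
    (hc : ∀ s, 0 < s → IsMAPClassifier p Φ S s (c s)) :
    Tendsto (fun s => errorProb p Φ S s (c s)) (𝓝[>] 0) (𝓝 0) := by
  have hple : ∀ i, p i ≤ 1 := fun i =>
    hp1 ▸ Finset.single_le_sum (fun j _ => hp0 j) (Finset.mem_univ i)
  have hpair : ∀ i j, i ≠ j → Tendsto (fun s => ENNReal.ofReal (p i) *
      measurementLaw Φ (S i) s {y | c s y = j}) (𝓝[>] 0) (𝓝 0) := by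
    intro i j hij
    rw [ENNReal.tendsto_nhds_zero]
    intro η hη
    -- Three errors: large noise under class `i`, large noise under class `j`, and a noiseless class
    -- `j` measurement within `ε` of `U`. The test radius is `ε / 2` because noise below `ε / 2` can
    -- at most double it.
    have hη3 : 0 < η / 3 := ENNReal.div_pos hη.ne' (by simp)
    set U := (LinearMap.range (S i).toEuclideanLin).map Φ.toEuclideanLin with hUdef
    obtain ⟨ε, hε, hε0⟩ := ((eventually_multivariateGaussian_infDist_lt Φ (hS j) U (hU i j hij)
      hη3).and self_mem_nhdsWithin).exists
    have hε2 : (0 : ℝ) < ε / 2 := half_pos hε0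
    filter_upwards [(tendsto_noise_norm (n := M) hε2).eventually_lt_const hη3,
      self_mem_nhdsWithin] with s hs hs0
    have hpe : ∀ k, ENNReal.ofReal (p k) ≤ 1 := fun k => by simpa using hple k
    calc _ ≤ _ := (hc s hs0).mul_measurementLaw_le hs0 i j (measurableSet_infDist_lt U (ε / 2))
      _ ≤ 1 * (η / 3) + 1 * (η / 3 + η / 3) := by
        gcongr
        · exact hpe i
        · exact (measurementLaw_compl_infDist_lt_le Φ (hS i) s (ε / 2)).trans hs.le
        · exact hpe j
        · refine (measurementLaw_infDist_lt_le Φ (S j) U s (ε / 2)).trans (add_le_add ?_ hs.le)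
          rw [mul_div_cancel₀ _ (two_ne_zero)]
          exact hε.le
      _ = η := by rw [one_mul, one_mul, ← add_assoc, ENNReal.add_thirds]
  have hbound : ∀ s, errorProb p Φ S s (c s) ≤ ∑ i, ∑ j ∈ Finset.univ.erase i,
      (ENNReal.ofReal (p i) * measurementLaw Φ (S i) s {y | c s y = j}).toReal := by
    intro s
    refine Finset.sum_le_sum fun i _ => ?_
    have : {y | c s y ≠ i} ⊆ ⋃ j ∈ Finset.univ.erase i, {y | c s y = j} := fun y hy => by
      simpa using hy
    calc _ ≤ p i * ∑ j ∈ Finset.univ.erase i, (measurementLaw Φ (S i) s).real {y | c s y = j} := by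
          refine mul_le_mul_of_nonneg_left ?_ (hp0 i)
          exact (measureReal_mono this (measure_ne_top _ _)).trans (measureReal_biUnion_finset_le _ _)
      _ = _ := by
          rw [Finset.mul_sum]
          simp [ENNReal.toReal_mul, ENNReal.toReal_ofReal (hp0 i), Measure.real]
  refine squeeze_zero (fun s => Finset.sum_nonneg fun i _ =>
    mul_nonneg (hp0 i) measureReal_nonneg) hbound ?_
  have hz : (0 : ℝ) = ∑ i : Fin L, ∑ j ∈ Finset.univ.erase i, (0 : ℝ) := by simp
  rw [congrArg 𝓝 hz]
  refine tendsto_finsetSum _ fun i _ => tendsto_finsetSum _ fun j hj => ?_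
  have := hpair i j (Finset.ne_of_mem_erase hj).symm
  exact (ENNReal.tendsto_toReal ENNReal.zero_ne_top).comp this

/-! ### Generic ranks of random vectors and matrices -/

/-- Rank is lower semicontinuous: the tuple is encoded continuously as the linear map whose range is
its span, and rank at least `n` is an open condition. -/
theorem measurable_finrank_span {k : ℕ} {F : Type*} [NormedAddCommGroup F] [NormedSpace ℝ F]
    [FiniteDimensional ℝ F] [MeasurableSpace F] [BorelSpace F] :
    Measurable fun w : Fin k → F => Module.finrank ℝ (Submodule.span ℝ (Set.range w)) := by
  let f : (Fin k → F) → ((Fin k → ℝ) →L[ℝ] F) := fun w =>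
    ∑ i, (ContinuousLinearMap.proj i : (Fin k → ℝ) →L[ℝ] ℝ).smulRight (w i)
  have hf : Continuous f := by
    refine continuous_finsetSum _ fun i _ => ?_
    exact ((ContinuousLinearMap.smulRightL ℝ (Fin k → ℝ) F
      (ContinuousLinearMap.proj i)).continuous).comp (continuous_apply i)
  have hr : ∀ w, LinearMap.range (f w : (Fin k → ℝ) →ₗ[ℝ] F) =
      Submodule.span ℝ (Set.range w) := by
    intro w
    rw [← Fintype.range_linearCombination]
    congr 1
    ext i
    simp [f, Fintype.linearCombination_apply]
  refine measurable_of_Ici fun n => ?_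
  have : (fun w : Fin k → F => Module.finrank ℝ (Submodule.span ℝ (Set.range w))) ⁻¹' Set.Ici n =
      f ⁻¹' {g | (n : Cardinal) ≤ (g : (Fin k → ℝ) →ₗ[ℝ] F).rank} := by
    ext w
    simp only [Set.mem_preimage, Set.mem_Ici, Set.mem_ofPred_eq, LinearMap.rank]
    rw [← Module.finrank_eq_rank, Nat.cast_le]
    have h := congrArg (fun K : Submodule ℝ F => Module.finrank ℝ K) (hr w)
    exact iff_of_eq (congrArg (n ≤ ·) h.symm)
  rw [this]
  exact ((isOpen_setOfPred_nat_le_rank n).preimage hf).measurableSet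

theorem finrank_span_singleton_sup {F : Type*} [AddCommGroup F] [Module ℝ F]
    [FiniteDimensional ℝ F] {x : F} {K : Submodule ℝ F} (hx : x ∉ K) :
    Module.finrank ℝ (Submodule.span ℝ {x} ⊔ K : Submodule ℝ F) = Module.finrank ℝ K + 1 := by
  have hx0 : x ≠ 0 := fun h => hx (h ▸ K.zero_mem)
  have hd : Submodule.span ℝ {x} ⊓ K = ⊥ :=
    disjoint_iff.1 ((Submodule.disjoint_span_singleton' hx0).2 hx).symm
  have h := Submodule.finrank_sup_add_finrank_inf_eq (Submodule.span ℝ {x}) K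
  rw [hd, finrank_bot, finrank_span_singleton hx0] at h
  omega

/-- The images under a linear map of independent vectors whose law does not charge proper subspaces
almost surely span as much as their number and the rank of the map permit. -/
theorem ae_finrank_span_comp {E F : Type*} [NormedAddCommGroup E] [NormedSpace ℝ E]
    [FiniteDimensional ℝ E] [MeasurableSpace E] [BorelSpace E] [NormedAddCommGroup F]
    [NormedSpace ℝ F] [FiniteDimensional ℝ F] (μ : Measure E) [SigmaFinite μ]
    (hμ : ∀ K : Submodule ℝ E, K ≠ ⊤ → μ K = 0) (T : E →ₗ[ℝ] F) (k : ℕ) :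
    ∀ᵐ v ∂(Measure.pi fun _ : Fin k => μ),
      Module.finrank ℝ (Submodule.span ℝ (Set.range (T ∘ v))) =
        min k (Module.finrank ℝ (LinearMap.range T)) := by
  borelize F
  have hT : Continuous T := LinearMap.continuous_of_finiteDimensional T
  induction k with
  | zero => exact Eventually.of_forall fun v => by simp
  | succ k ih =>
    have hmp := (measurePreserving_piFinSuccAbove (fun _ : Fin (k + 1) => μ) 0).symm
    rw [← hmp.map_eq]
    have hms : MeasurableSet {v : Fin (k + 1) → E |
        Module.finrank ℝ (Submodule.span ℝ (Set.range (T ∘ v))) =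
          min (k + 1) (Module.finrank ℝ (LinearMap.range T))} :=
      (measurable_finrank_span.comp (measurable_pi_lambda (fun v : Fin (k + 1) → E => T ∘ v)
        fun i => hT.measurable.comp (measurable_pi_apply i))) (measurableSet_singleton _)
    rw [ae_map_iff hmp.measurable.aemeasurable hms]
    refine (Measure.ae_prod_iff_ae_ae (hmp.measurable hms)).2 ?_
    -- Swap the quantifiers: the `k` old vectors `w` are fixed, then the new vector `x` is drawn.
    refine (Measure.ae_ae_comm (p := fun x w => Module.finrank ℝ (Submodule.span ℝ (Set.range (T ∘
      (MeasurableEquiv.piFinSuccAbove (fun _ : Fin (k + 1) => E) 0).symm (x, w)))) =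
        min (k + 1) (Module.finrank ℝ (LinearMap.range T))) (hmp.measurable hms)).2 ?_
    filter_upwards [ih] with w hw
    set K := Submodule.span ℝ (Set.range (T ∘ w)) with hK
    have hspan : ∀ x, Submodule.span ℝ (Set.range (T ∘
        (MeasurableEquiv.piFinSuccAbove (fun _ : Fin (k + 1) => E) 0).symm (x, w))) =
        Submodule.span ℝ {T x} ⊔ K := by
      intro x
      have : T ∘ (MeasurableEquiv.piFinSuccAbove (fun _ : Fin (k + 1) => E) 0).symm (x, w) =
          Fin.cons (T x) (T ∘ w) := by
        ext i
        refine Fin.cases ?_ (fun i => ?_) i <;>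
          simp [MeasurableEquiv.piFinSuccAbove]
      rw [this, Fin.range_cons, Submodule.span_insert]
    have hKr : K ≤ LinearMap.range T :=
      Submodule.span_le.2 (by rintro _ ⟨i, rfl⟩; exact ⟨_, rfl⟩)
    suffices ∀ᵐ x ∂μ, Module.finrank ℝ (Submodule.span ℝ {T x} ⊔ K : Submodule ℝ F) =
        min (k + 1) (Module.finrank ℝ (LinearMap.range T)) by
      filter_upwards [this] with x hx
      rw [hspan x, hx]
    rcases lt_or_ge k (Module.finrank ℝ (LinearMap.range T)) with hlt | hge
    · rw [min_eq_left hlt.le] at hw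
      rw [min_eq_left (Nat.succ_le_of_lt hlt)]
      -- While `K` is smaller than the range of `T`, its preimage is proper, hence null, and the new
      -- vector raises the dimension by one.
      have hne : K.comap T ≠ ⊤ := by
        intro htop
        have : LinearMap.range T ≤ K := by
          rintro _ ⟨x, rfl⟩
          have : x ∈ K.comap T := htop ▸ Submodule.mem_top
          exact this
        have := Submodule.finrank_mono this
        omega
      have h0 := hμ _ hne
      filter_upwards [measure_eq_zero_iff_ae_notMem.1 h0] with x hx
      rw [finrank_span_singleton_sup (show T x ∉ K from hx), hw]
    · rw [min_eq_right hge] at hw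
      rw [min_eq_right (by omega)]
      have hKe : K = LinearMap.range T := Submodule.eq_of_le_of_finrank_eq hKr hw
      refine Eventually.of_forall fun x => ?_
      rw [hKe, sup_eq_right.2]
      simp

/-- The rows of `A * B` are the images of the rows of `A` under `v ↦ v B`, and Lebesgue measure on
matrices is the product of those on the rows. -/
theorem ae_rank_mul {M N : ℕ} (B : Matrix (Fin N) (Fin N) ℝ) :
    ∀ᵐ A : Fin M → Fin N → ℝ, (Matrix.of A * B).rank = min M B.rank := by
  have h := ae_finrank_span_comp (volume : Measure (Fin N → ℝ))
    (fun K hK => Measure.addHaar_submodule _ K hK) B.vecMulLinear M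
  rw [range_vecMulLinear, ← Matrix.rank_eq_finrank_span_row] at h
  filter_upwards [h] with A hA
  rw [Matrix.rank_eq_finrank_span_row, ← hA]
  rfl

theorem measurable_rank {m n : ℕ} :
    Measurable fun A : Fin m → Fin n → ℝ => (Matrix.of A).rank := by
  simp only [Matrix.rank_eq_finrank_span_row]
  exact measurable_finrank_span

theorem measurable_rank_mul {m n k : ℕ} :
    Measurable fun q : (Fin m → Fin n → ℝ) × (Fin n → Fin k → ℝ) =>
      (Matrix.of q.1 * Matrix.of q.2).rank := by
  refine measurable_rank.comp (f := fun q : (Fin m → Fin n → ℝ) × (Fin n → Fin k → ℝ) =>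
    (Matrix.of.symm (Matrix.of q.1 * Matrix.of q.2))) ?_
  refine measurable_pi_lambda _ fun a => measurable_pi_lambda _ fun b => ?_
  simp only [Matrix.of_symm_apply, Matrix.mul_apply, Matrix.of_apply]
  fun_prop

/-- A random matrix whose entries have a joint density preserves rank as much as possible when
multiplied by an independent random matrix. -/
theorem ae_rank_mul_of_indepFun {Ω : Type*} [MeasurableSpace Ω] {P : Measure Ω}
    [IsProbabilityMeasure P] {M N : ℕ} {Φ : Ω → Fin M → Fin N → ℝ} (hΦ : Measurable Φ)
    (hΦac : P.map Φ ≪ volume) {B : Ω → Fin N → Fin N → ℝ} (hB : Measurable B)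
    (hind : IndepFun Φ B P) :
    ∀ᵐ ω ∂P, (Matrix.of (Φ ω) * Matrix.of (B ω)).rank = min M (Matrix.of (B ω)).rank := by
  have hms : MeasurableSet {q : (Fin M → Fin N → ℝ) × (Fin N → Fin N → ℝ) |
      (Matrix.of q.1 * Matrix.of q.2).rank = min M (Matrix.of q.2).rank} :=
    measurableSet_eq_fun measurable_rank_mul
      (measurable_const.min (measurable_rank.comp measurable_snd))
  have hpr : AEMeasurable (fun ω => (Φ ω, B ω)) P := (hΦ.prodMk hB).aemeasurable
  have hmap := (indepFun_iff_map_prod_eq_prod_map_map hΦ.aemeasurable hB.aemeasurable).1 hind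
  have := Measure.isProbabilityMeasure_map (μ := P) hΦ.aemeasurable
  have := Measure.isProbabilityMeasure_map (μ := P) hB.aemeasurable
  refine (ae_map_iff hpr hms).1 ?_
  rw [hmap, Measure.ae_prod_iff_ae_ae hms]
  refine (Measure.ae_ae_comm hms).2 (Eventually.of_forall fun b => ?_)
  exact hΦac.ae_le (ae_rank_mul (Matrix.of b))

/-! ### Images of positive semidefinite matrices -/

theorem toEuclideanLin_mul {l m n : ℕ} (A : Matrix (Fin l) (Fin m) ℝ)
    (B : Matrix (Fin m) (Fin n) ℝ) :
    (A * B).toEuclideanLin = A.toEuclideanLin ∘ₗ B.toEuclideanLin := by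
  ext x
  simp [Matrix.toLpLin_apply]

open scoped MatrixOrder in
theorem rank_mul_mul_transpose {M N : ℕ} (Φ : Matrix (Fin M) (Fin N) ℝ)
    {S : Matrix (Fin N) (Fin N) ℝ} (hS : S.PosSemidef) :
    (Φ * S * Φ.transpose).rank =
      Module.finrank ℝ ((LinearMap.range S.toEuclideanLin).map Φ.toEuclideanLin) := by
  have hsq : CFC.sqrt S * CFC.sqrt S = S := CFC.sqrt_mul_sqrt_self _ hS.nonneg
  have hsym : (CFC.sqrt S).transpose = CFC.sqrt S :=
    (Matrix.nonneg_iff_posSemidef.1 (CFC.sqrt_nonneg S)).isHermitian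
  have h : Φ * S * Φ.transpose = (Φ * CFC.sqrt S) * (Φ * CFC.sqrt S).transpose := by
    conv_lhs => rw [← hsq]
    rw [Matrix.transpose_mul, hsym]
    simp only [Matrix.mul_assoc]
  rw [h, Matrix.rank_self_mul_transpose, ← range_toEuclideanLin_sqrt hS, ← LinearMap.range_comp,
    ← finrank_range_toEuclideanLin, toEuclideanLin_mul]

theorem finrank_map_range {M N : ℕ} (Φ : Matrix (Fin M) (Fin N) ℝ)
    (B : Matrix (Fin N) (Fin N) ℝ) :
    Module.finrank ℝ ((LinearMap.range B.toEuclideanLin).map Φ.toEuclideanLin) =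
      (Φ * B).rank := by
  rw [← LinearMap.range_comp, ← finrank_range_toEuclideanLin, toEuclideanLin_mul]

/-- Pass to orthogonal complements: if `x` is orthogonal to the image of `S + T`, then `xᵀSx + xᵀTx
= 0` with both terms nonnegative, so `S x = 0`, and by symmetry `x` is orthogonal to the image of
`S`. -/
theorem range_toEuclideanLin_le_add {N : ℕ} {S T : Matrix (Fin N) (Fin N) ℝ}
    (hS : S.PosSemidef) (hT : T.PosSemidef) :
    LinearMap.range S.toEuclideanLin ≤ LinearMap.range (S + T).toEuclideanLin := by
  rw [← Submodule.orthogonal_le_orthogonal_iff]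
  intro x hx
  have h1 := (Submodule.mem_orthogonal' _ _).1 hx _ (LinearMap.mem_range_self _ x)
  have h2 : x.ofLp ⬝ᵥ S.mulVec x.ofLp + x.ofLp ⬝ᵥ T.mulVec x.ofLp = 0 := by
    rw [← dotProduct_add, ← h1]
    simp [Matrix.toLpLin_apply, PiLp.inner_apply, dotProduct, mul_comm]
  have h3 : x.ofLp ⬝ᵥ S.mulVec x.ofLp = 0 := by
    have a := hS.dotProduct_mulVec_nonneg x.ofLp
    have b := hT.dotProduct_mulVec_nonneg x.ofLp
    simp only [star_trivial] at a b
    linarith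
  have h4 : S.mulVec x.ofLp = 0 := (hS.dotProduct_mulVec_zero_iff x.ofLp).1 (by simpa using h3)
  rw [Submodule.mem_orthogonal']
  rintro _ ⟨z, rfl⟩
  have hSt : S.transpose = S := hS.isHermitian
  have : x.ofLp ⬝ᵥ S.mulVec z.ofLp = 0 := by
    rw [Matrix.dotProduct_mulVec, ← Matrix.mulVec_transpose, hSt, h4, zero_dotProduct]
  rw [← this]
  simp [Matrix.toLpLin_apply, PiLp.inner_apply, dotProduct, mul_comm]

theorem range_toEuclideanLin_add {N : ℕ} {S T : Matrix (Fin N) (Fin N) ℝ}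
    (hS : S.PosSemidef) (hT : T.PosSemidef) :
    LinearMap.range (S + T).toEuclideanLin =
      LinearMap.range S.toEuclideanLin ⊔ LinearMap.range T.toEuclideanLin := by
  refine le_antisymm ?_ (sup_le (range_toEuclideanLin_le_add hS hT) ?_)
  · rintro _ ⟨x, rfl⟩
    rw [map_add, LinearMap.add_apply]
    exact Submodule.add_mem_sup (LinearMap.mem_range_self _ x) (LinearMap.mem_range_self _ x)
  · rw [add_comm]
    exact range_toEuclideanLin_le_add hT hS

/-! ### Measurability on the Grassmann manifold through projection matrices -/

/-- The matrix of the orthogonal projection onto a point of the Grassmann manifold. -/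
noncomputable def Grassmann.projMatrix {N r : ℕ} (V : Grassmann N r) : Matrix (Fin N) (Fin N) ℝ :=
  Matrix.toEuclideanLin.symm V.toSubmodule.starProjection.toLinearMap

theorem Grassmann.toEuclideanLin_projMatrix {N r : ℕ} (V : Grassmann N r) :
    V.projMatrix.toEuclideanLin = V.toSubmodule.starProjection.toLinearMap :=
  Matrix.toEuclideanLin.apply_symm_apply _

theorem Grassmann.range_projMatrix {N r : ℕ} (V : Grassmann N r) :
    LinearMap.range V.projMatrix.toEuclideanLin = V.toSubmodule := by
  rw [V.toEuclideanLin_projMatrix]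
  exact Submodule.range_starProjection _

theorem Grassmann.posSemidef_projMatrix {N r : ℕ} (V : Grassmann N r) :
    V.projMatrix.PosSemidef := by
  rw [← Matrix.isPositive_toEuclideanLin_iff, V.toEuclideanLin_projMatrix]
  exact (ContinuousLinearMap.isPositive_toLinearMap_iff _).2
    (ContinuousLinearMap.IsPositive.of_isStarProjection isStarProjection_starProjection)

theorem Grassmann.projMatrix_apply {N r : ℕ} (V : Grassmann N r) (a b : Fin N) :
    V.projMatrix a b = V.toSubmodule.starProjection (EuclideanSpace.single b 1) a := by
  have h := congrArg (fun f => f (EuclideanSpace.single b 1) a) V.toEuclideanLin_projMatrix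
  simpa [Matrix.toLpLin_apply] using h

/-- These are the normal equations of least squares. The formula makes the projection visibly
continuous in the frame, which suffices for the quotient topology. -/
theorem starProjection_span_frame {N r : ℕ} (v : Frame N r) (x : EuclideanSpace ℝ (Fin N)) :
    v.span.toSubmodule.starProjection x =
      ∑ k, ((Matrix.gram ℝ v.1)⁻¹.mulVec fun l => inner ℝ (v.1 l) x) k • v.1 k := by
  have hdet : IsUnit (Matrix.gram ℝ v.1).det :=
    (Matrix.posDef_gram_of_linearIndependent v.2).det_pos.ne'.isUnit
  refine Submodule.eq_starProjection_of_mem_of_inner_eq_zero (K := v.span.toSubmodule) ?_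
    fun w hw => ?_
  · exact Submodule.sum_mem _ fun k _ =>
      Submodule.smul_mem _ _ (Submodule.subset_span (Set.mem_range_self k))
  · set c := (Matrix.gram ℝ v.1)⁻¹.mulVec fun l => inner ℝ (v.1 l) x with hc
    have hGc : (Matrix.gram ℝ v.1).mulVec c = fun l => inner ℝ (v.1 l) x := by
      rw [hc, Matrix.mulVec_mulVec, Matrix.mul_nonsing_inv _ hdet, Matrix.one_mulVec]
    have hw' : w ∈ Submodule.span ℝ (Set.range v.1) := hw
    induction hw' using Submodule.span_induction with
    | mem y hy =>
      obtain ⟨l, rfl⟩ := hy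
      have := congrFun hGc l
      rw [real_inner_comm, inner_sub_right, inner_sum, ← this]
      simp [Matrix.mulVec, dotProduct, Matrix.gram_apply, inner_smul_right, mul_comm]
    | zero => simp
    | add y z hy hz ihy ihz => rw [inner_add_right, ihy hy, ihz hz, add_zero]
    | smul a y hy ih => rw [inner_smul_right, ih hy, mul_zero]

theorem continuous_gram_inv {N r : ℕ} : Continuous fun v : Frame N r => (Matrix.gram ℝ v.1)⁻¹ := by
  have hg : Continuous fun v : Frame N r => Matrix.gram ℝ v.1 := by
    refine continuous_matrix fun i j => ?_
    simp only [Matrix.gram_apply]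
    exact ((continuous_apply i).comp continuous_subtype_val).inner
      ((continuous_apply j).comp continuous_subtype_val)
  simp only [Matrix.inv_def, Ring.inverse_eq_inv']
  exact (hg.matrix_det.inv₀ fun v =>
    (Matrix.posDef_gram_of_linearIndependent v.2).det_pos.ne').smul hg.matrix_adjugate

theorem Grassmann.continuous_projMatrix_apply {N r : ℕ} (a b : Fin N) :
    Continuous fun V : Grassmann N r => V.projMatrix a b := by
  rw [continuous_coinduced_dom]
  have h : (fun V : Grassmann N r => V.projMatrix a b) ∘ Frame.span = fun v : Frame N r =>
      (∑ k, ((Matrix.gram ℝ v.1)⁻¹.mulVec fun l => inner ℝ (v.1 l) (EuclideanSpace.single b 1)) k •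
        v.1 k) a := by
    ext v
    rw [← starProjection_span_frame, Function.comp_apply, Grassmann.projMatrix_apply]
  rw [h]
  have hv : ∀ k, Continuous fun v : Frame N r => v.1 k := fun k =>
    (continuous_apply k).comp continuous_subtype_val
  have hm : Continuous fun v : Frame N r => (Matrix.gram ℝ v.1)⁻¹.mulVec fun l =>
      inner ℝ (v.1 l) (EuclideanSpace.single b (1 : ℝ)) :=
    continuous_gram_inv.matrix_mulVec (continuous_pi fun l => (hv l).inner continuous_const)
  have hs : Continuous fun v : Frame N r => ∑ k, ((Matrix.gram ℝ v.1)⁻¹.mulVec fun l =>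
      inner ℝ (v.1 l) (EuclideanSpace.single b (1 : ℝ))) k • v.1 k :=
    continuous_finsetSum _ fun k _ => ((continuous_apply k).comp hm).smul (hv k)
  fun_prop

theorem Grassmann.measurable_projMatrix {N r : ℕ} :
    Measurable fun V : Grassmann N r => (fun a b => V.projMatrix a b : Fin N → Fin N → ℝ) :=
  measurable_pi_lambda _ fun a => measurable_pi_lambda _ fun b =>
    (Grassmann.continuous_projMatrix_apply a b).measurable

theorem Frame.measurable_span {N r : ℕ} : Measurable (Frame.span : Frame N r → Grassmann N r) :=
  (continuous_coinduced_rng : Continuous (Frame.span : Frame N r → Grassmann N r)).measurable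

theorem Grassmann.rank_projMatrix_add {N r : ℕ} (V W : Grassmann N r) :
    (V.projMatrix + W.projMatrix).rank =
      Module.finrank ℝ (V.toSubmodule ⊔ W.toSubmodule : Submodule ℝ _) := by
  rw [← finrank_range_toEuclideanLin,
    range_toEuclideanLin_add V.posSemidef_projMatrix W.posSemidef_projMatrix,
    V.range_projMatrix, W.range_projMatrix]

/-! ### General position of random subspaces -/

/-- A subspace and the span of Gaussian vectors are almost surely in general position. -/
theorem ae_finrank_sup_span {N r : ℕ} (V : Submodule ℝ (EuclideanSpace ℝ (Fin N))) :
    ∀ᵐ w ∂(Measure.pi fun _ : Fin r => stdGaussian (EuclideanSpace ℝ (Fin N))),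
      Module.finrank ℝ (V ⊔ Submodule.span ℝ (Set.range w) : Submodule ℝ _) =
        min N (Module.finrank ℝ V + r) := by
  -- `Q` kills exactly `V`, so by rank-nullity on `V ⊔ W` the dimension sought is that of `V` plus
  -- that of the span of the projected vectors.
  set Q := Vᗮ.starProjection.toLinearMap with hQ
  have hker : LinearMap.ker Q = V := by
    rw [hQ]
    exact (Submodule.ker_starProjection _).trans V.orthogonal_orthogonal
  have hrange : Module.finrank ℝ (LinearMap.range Q) + Module.finrank ℝ V = N := by
    have h := LinearMap.finrank_range_add_finrank_ker Q
    rw [hker, finrank_euclideanSpace_fin] at h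
    exact h
  have h := ae_finrank_span_comp (stdGaussian (EuclideanSpace ℝ (Fin N)))
    (fun K hK => stdGaussian_absolutelyContinuous N (Measure.addHaar_submodule _ K hK)) Q r
  filter_upwards [h] with w hw
  set W := Submodule.span ℝ (Set.range w) with hW
  have hmap : LinearMap.range (Q.domRestrict (V ⊔ W)) = Submodule.span ℝ (Set.range (Q ∘ w)) := by
    rw [LinearMap.range_domRestrict, Submodule.map_sup, LinearMap.le_ker_iff_map.1 hker.ge,
      bot_sup_eq, hW, Submodule.map_span, Set.range_comp]
  have h2 := LinearMap.finrank_range_add_finrank_ker (Q.domRestrict (V ⊔ W))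
  have h3 : Module.finrank ℝ (LinearMap.ker (Q.domRestrict (V ⊔ W))) = Module.finrank ℝ V := by
    rw [LinearMap.ker_domRestrict, hker]
    exact (Submodule.comapSubtypeEquivOfLe le_sup_left).finrank_eq
  rw [hmap, hw, h3] at h2
  omega

theorem measurableSet_frame {N r : ℕ} :
    MeasurableSet {v : Fin r → EuclideanSpace ℝ (Fin N) | LinearIndependent ℝ v} :=
  isOpen_setOfPred_linearIndependent.measurableSet

theorem Grassmann.measurable_finrank_sup {N r : ℕ} :
    Measurable fun q : Grassmann N r × Grassmann N r =>
      Module.finrank ℝ (q.1.toSubmodule ⊔ q.2.toSubmodule : Submodule ℝ _) := by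
  simp only [← Grassmann.rank_projMatrix_add]
  exact measurable_rank.comp ((measurable_projMatrix.comp measurable_fst).add
    (measurable_projMatrix.comp measurable_snd))

/-- Two independent random subspaces with densities are almost surely in general position. -/
theorem Grassmann.ae_finrank_sup {N r : ℕ} (μ ν : Measure (Grassmann N r)) [SFinite μ] [SFinite ν]
    (hμ : HasDensity μ) (hν : HasDensity ν) :
    ∀ᵐ q ∂(μ.prod ν), Module.finrank ℝ (q.1.toSubmodule ⊔ q.2.toSubmodule : Submodule ℝ _) =
      min N (2 * r) := by
  obtain ⟨f, -, hμf⟩ := hμ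
  obtain ⟨g, -, hνg⟩ := hν
  have hμac : μ ≪ Grassmann.uniform N r := hμf ▸ withDensity_absolutelyContinuous _ _
  have hνac : ν ≪ Grassmann.uniform N r := hνg ▸ withDensity_absolutelyContinuous _ _
  have : SFinite (Grassmann.uniform N r) := by
    rw [Grassmann.uniform]; infer_instance
  refine (hμac.prod hνac).ae_le ?_
  have hms : MeasurableSet {q : Grassmann N r × Grassmann N r |
      Module.finrank ℝ (q.1.toSubmodule ⊔ q.2.toSubmodule : Submodule ℝ _) = min N (2 * r)} :=
    measurable_finrank_sup (measurableSet_singleton _)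
  refine (Measure.ae_prod_iff_ae_ae hms).2 (Eventually.of_forall fun V => ?_)
  have hms' : MeasurableSet {W : Grassmann N r |
      Module.finrank ℝ (V.toSubmodule ⊔ W.toSubmodule : Submodule ℝ _) = min N (2 * r)} :=
    measurable_prodMk_left hms
  rw [Grassmann.uniform, ae_map_iff Frame.measurable_span.aemeasurable hms', ae_iff,
    comap_subtype_coe_apply measurableSet_frame]
  -- The comap measure of the bad frames is the Gaussian measure of the same tuples, which lie in a
  -- null set.
  refine measure_mono_null ?_ (ae_iff.1 (ae_finrank_sup_span (r := r) V.toSubmodule))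
  rintro _ ⟨w, hw, rfl⟩ h
  refine hw (h.trans ?_)
  rw [show Module.finrank ℝ V.toSubmodule = r from V.2, two_mul]

end LowNoise

/-! ### The main theorem -/

theorem proposition1 {Ω : Type*} [MeasurableSpace Ω] (P : Measure Ω) [IsProbabilityMeasure P]
    (L M N r : ℕ) (hrN : r < N)
    -- the class probabilities
    (p : Fin L → ℝ) (hp0 : ∀ i, 0 ≤ p i) (hp1 : ∑ i, p i = 1)
    -- the covariance matrices; their images are points of the Grassmann manifold
    (S : Fin L → Ω → Matrix (Fin N) (Fin N) ℝ) (hS : ∀ i ω, (S i ω).PosSemidef)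
    (R : Fin L → Ω → LowNoise.Grassmann N r)
    (hR : ∀ i ω, (R i ω).toSubmodule = LinearMap.range (S i ω).toEuclideanLin)
    -- the images are independent random subspaces with a density
    (hRmeas : ∀ i, Measurable (R i)) (hRindep : iIndepFun R P)
    (hRdens : ∀ i, LowNoise.Grassmann.HasDensity (P.map (R i)))
    -- the random measurement matrix, independent of these subspaces
    (Φ : Ω → Fin M → Fin N → ℝ) (hΦmeas : Measurable Φ)
    (hΦinv : LowNoise.IsLeftRotationInvariant (P.map Φ))
    (hΦindep : IndepFun Φ (fun ω i => R i ω) P) :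
    (∀ᵐ ω ∂P,
      (∀ i, (Matrix.of (Φ ω) * S i ω * (Matrix.of (Φ ω)).transpose).rank = min M r) ∧
      (∀ i j, i ≠ j →
        (Matrix.of (Φ ω) * (S i ω + S j ω) * (Matrix.of (Φ ω)).transpose).rank
          = min M (min N (2 * r)))) ∧
    (0 < r → r + 1 ≤ M →
      ∀ᵐ ω ∂P, ∀ c : ℝ → EuclideanSpace ℝ (Fin M) → Fin L,
        (∀ s, 0 < s →
          LowNoise.IsMAPClassifier p (Matrix.of (Φ ω)) (fun i => S i ω) s (c s)) →
        Tendsto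
          (fun s => LowNoise.errorProb p (Matrix.of (Φ ω)) (fun i => S i ω) s (c s))
          (𝓝[>] 0) (𝓝 0)) := by
  have hΦac : P.map Φ ≪ volume := by
    obtain ⟨f, -, hf, -⟩ := hΦinv
    exact hf ▸ withDensity_absolutelyContinuous _ _
  have hone : ∀ i, ∀ᵐ ω ∂P, (Matrix.of (Φ ω) * S i ω * (Matrix.of (Φ ω)).transpose).rank =
      min M r := by
    intro i
    -- Measurability and independence are assumed of the images `R i`, not of `S i`. The projection
    -- matrix is a measurable function of `R i` with the same image as `S i`, so it replaces `S i`
    -- in the rank computation.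
    have hm := LowNoise.Grassmann.measurable_projMatrix (N := N) (r := r)
    filter_upwards [LowNoise.ae_rank_mul_of_indepFun hΦmeas hΦac (hm.comp (hRmeas i))
      (hΦindep.comp measurable_id (hm.comp (measurable_pi_apply i)))] with ω hω
    have hrank : (R i ω).projMatrix.rank = r := by
      rw [← LowNoise.finrank_range_toEuclideanLin, LowNoise.Grassmann.range_projMatrix]
      exact (R i ω).2
    rw [LowNoise.rank_mul_mul_transpose _ (hS i ω), ← hR, ← LowNoise.Grassmann.range_projMatrix,
      LowNoise.finrank_map_range]
    exact hω.trans (congrArg (min M) hrank)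
  have htwo : ∀ i j, i ≠ j → ∀ᵐ ω ∂P,
      (Matrix.of (Φ ω) * (S i ω + S j ω) * (Matrix.of (Φ ω)).transpose).rank =
        min M (min N (2 * r)) := by
    intro i j hij
    have hm : Measurable fun q : LowNoise.Grassmann N r × LowNoise.Grassmann N r =>
        (fun a b => q.1.projMatrix a b + q.2.projMatrix a b : Fin N → Fin N → ℝ) :=
      (LowNoise.Grassmann.measurable_projMatrix.comp measurable_fst).add
        (LowNoise.Grassmann.measurable_projMatrix.comp measurable_snd)
    have hpair : ∀ᵐ ω ∂P, Module.finrank ℝ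
        ((R i ω).toSubmodule ⊔ (R j ω).toSubmodule : Submodule ℝ _) = min N (2 * r) := by
      have := Measure.isProbabilityMeasure_map (μ := P) (hRmeas i).aemeasurable
      have := Measure.isProbabilityMeasure_map (μ := P) (hRmeas j).aemeasurable
      have h := LowNoise.Grassmann.ae_finrank_sup _ _ (hRdens i) (hRdens j)
      rw [← (indepFun_iff_map_prod_eq_prod_map_map (hRmeas i).aemeasurable
        (hRmeas j).aemeasurable).1 (hRindep.indepFun hij)] at h
      exact ae_of_ae_map ((hRmeas i).prodMk (hRmeas j)).aemeasurable h
    filter_upwards [hpair, LowNoise.ae_rank_mul_of_indepFun hΦmeas hΦac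
      (hm.comp ((hRmeas i).prodMk (hRmeas j))) (hΦindep.comp measurable_id
        (hm.comp ((measurable_pi_apply i).prodMk (measurable_pi_apply j))))] with ω h1 h2
    have hrank := ((R i ω).rank_projMatrix_add (R j ω)).trans h1
    rw [LowNoise.rank_mul_mul_transpose _ ((hS i ω).add (hS j ω)),
      LowNoise.range_toEuclideanLin_add (hS i ω) (hS j ω), ← hR, ← hR, ← (R i ω).range_projMatrix,
      ← (R j ω).range_projMatrix, ← LowNoise.range_toEuclideanLin_add (R i ω).posSemidef_projMatrix
        (R j ω).posSemidef_projMatrix, LowNoise.finrank_map_range]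
    exact h2.trans (congrArg (min M) hrank)
  have hall : ∀ᵐ ω ∂P,
      (∀ i, (Matrix.of (Φ ω) * S i ω * (Matrix.of (Φ ω)).transpose).rank = min M r) ∧
      (∀ i j, i ≠ j →
        (Matrix.of (Φ ω) * (S i ω + S j ω) * (Matrix.of (Φ ω)).transpose).rank
          = min M (min N (2 * r))) := by
    refine (ae_all_iff.2 hone).and (ae_all_iff.2 fun i => ae_all_iff.2 fun j => ?_)
    by_cases hij : i = j
    · exact Eventually.of_forall fun _ h => absurd hij h
    · filter_upwards [htwo i j hij] with ω h _ using h
  refine ⟨hall, fun hr hM => ?_⟩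
  filter_upwards [hall] with ω hω c hc
  refine LowNoise.tendsto_errorProb p hp0 hp1 (Matrix.of (Φ ω)) (fun i => S i ω) (fun i => hS i ω)
    (fun i j hij hle => ?_) c hc
  have h1 := hω.1 i
  have h2 := hω.2 i j hij
  rw [LowNoise.rank_mul_mul_transpose _ (hS i ω)] at h1
  rw [LowNoise.rank_mul_mul_transpose _ ((hS i ω).add (hS j ω)),
    LowNoise.range_toEuclideanLin_add (hS i ω) (hS j ω),
    Submodule.map_sup, sup_eq_left.2 hle] at h2
  -- The inclusion `hle` collapses the sum, so `h1` and `h2` give the same space dimensions `min M r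
  -- = r` and `min M (min N (2 * r)) > r`.
  omega
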